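/- Let $\mathcal L\subseteq\{+,-,0\}^E$ be (the covector set of) an oriented matroid on a finite ground set $E$, and let $\mathcal T$ be its set of topes, i.e. of maximal covectors with respect to the product order induced by $0<+$ and $0<-$. For $P,Q\in\mathcal T$ put $\mathrm{Sep}(P,Q)=\{f\in E : P_f=-Q_f\neq 0\}$. Let $e\in E$ and let $R,P\in\mathcal T$ be topes with $R_e=+$ and $P_e=-$. Order $\mathcal T$ by $T\preceq_R T'$ if and only if $\mathrm{Sep}(R,T)\subseteq\mathrm{Sep}(R,T')$, and let $\mathcal T_{R,e}=\{T\in\mathcal T : T_e=-R_e\}\cup\{\hat 0\}$, where $\hat 0$ is a new least element and the remaining order is the one induced by $\preceq_R$. For $Q\in\mathcal T$ with $Q_e=-$ let $(\hat 0,Q)_{R,e}$ be the open interval from $\hat 0$ to $Q$ in $\mathcal T_{R,e}$, and let $\mu((\hat 0,Q)_{R,e})$ be its Möbius number, where the Möbius number of a finite poset is the value $\mu(\hat 0,\hat 1)$ of the Möbius function of the poset obtained by adjoining a new least element $\hat 0$ and a new greatest element $\hat 1$. Then for every $S\subseteq E$ with $e\notin S$, $$\sum_{\substack{Q\in\mathcal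 T,\ Q_e=-\\ \mathrm{Sep}(P,Q)\cap\mathrm{Sep}(Q,R)=S}}\mu\big((\hat 0,Q)_{R,e}\big)=\begin{cases}-1 & \text{if } S=\emptyset,\\ 0 & \text{if } S\neq\emptyset.\end{cases}$$ -/

import Mathlib

/-- Composition of sign vectors: `X ∘ Y` agrees with `X` where `X` is nonzero, and with `Y`
elsewhere. -/
def signComp {E : Type*} (X Y : E → SignType) : E → SignType :=
  fun e => if X e = 0 then Y e else X e

/-- The separator `Sep(X, Y) = {e | X_e = -Y_e ≠ 0}` of two sign vectors. -/
def signSep {E : Type*} (X Y : E → SignType) : Set E :=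
  {e | X e = -Y e ∧ X e ≠ 0}

/-- The order on sign vectors which is the product of the orders `0 < +`, `0 < -` on the
coordinates, with `+` and `-` incomparable (this is not the linear order of `SignType`). -/
def signLE {E : Type*} (X Y : E → SignType) : Prop :=
  ∀ e, X e = 0 ∨ X e = Y e

/-- An oriented matroid on the ground set `E`, given by its covectors and the covector axioms. -/
structure OrientedMatroid (E : Type*) where
  /-- The set of covectors. -/
  covectors : Set (E → SignType)
  zero_mem : (fun _ => 0) ∈ covectors
  neg_mem : ∀ X ∈ covectors, (fun e => -X e) ∈ covectors
  comp_mem : ∀ X ∈ covectors, ∀ Y ∈ covectors, signComp X Y ∈ covectors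
  elim : ∀ X ∈ covectors, ∀ Y ∈ covectors, ∀ e ∈ signSep X Y,
    ∃ Z ∈ covectors, Z e = 0 ∧
      ∀ f, f ∉ signSep X Y → Z f = signComp X Y f ∧ Z f = signComp Y X f

namespace OrientedMatroid

variable {E : Type*} (L : OrientedMatroid E)

/-- The topes: the maximal covectors. -/
def Tope : Type _ :=
  {T : E → SignType // T ∈ L.covectors ∧ ∀ X ∈ L.covectors, signLE T X → X = T}

variable {L}

/-- The sign vector of a tope. -/
def Tope.sign (T : L.Tope) : E → SignType := T.1

/-- The separator of two topes. -/
def Tope.sep (P Q : L.Tope) : Set E := signSep P.sign Q.sign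

variable (L) in
/-- The set `𝒯(S⁺, S⁻)` of topes which are `+` on `S⁺` and `-` on `S⁻`. -/
def supertope (Spos Sneg : Set E) : Set L.Tope :=
  {T | (∀ f ∈ Spos, T.sign f = 1) ∧ ∀ f ∈ Sneg, T.sign f = -1}

/-- All topes vanish on the same elements (the loops). -/
theorem Tope.eq_zero_of_eq_zero (P Q : L.Tope) (e : E) (h : P.sign e = 0) : Q.sign e = 0 := by
  have h1 := P.2.2 (signComp P.1 Q.1) (L.comp_mem _ P.2.1 _ Q.2.1) (fun f => by
    by_cases hf : P.1 f = 0
    · exact Or.inl hf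
    · right; simp [signComp, hf])
  have h2 := congrFun h1 e
  have h' : P.1 e = 0 := h
  simp only [signComp, h', if_true] at h2
  exact h2

/-- A tope is determined by its separator from a fixed tope. -/
theorem Tope.eq_of_sep_eq (R P Q : L.Tope) (h : R.sep P = R.sep Q) : P = Q := by
  apply Subtype.ext
  funext e
  change P.sign e = Q.sign e
  have he : (R.sign e = -P.sign e ∧ R.sign e ≠ 0) ↔ (R.sign e = -Q.sign e ∧ R.sign e ≠ 0) :=
    Set.ext_iff.1 h e
  have a := Tope.eq_zero_of_eq_zero R P e
  have b := Tope.eq_zero_of_eq_zero R Q e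
  have c := Tope.eq_zero_of_eq_zero P R e
  have d := Tope.eq_zero_of_eq_zero Q R e
  revert he a b c d
  generalize R.sign e = r
  generalize P.sign e = p
  generalize Q.sign e = q
  revert r p q
  decide

/-- The set of topes, regarded as the carrier of the tope poset with base tope `R`. -/
def TopePoset (_R : L.Tope) : Type _ := L.Tope

/-- The tope poset `𝒯_R`: `P ≼ Q` if and only if `Sep(R, P) ⊆ Sep(R, Q)`. -/
instance (R : L.Tope) : PartialOrder (TopePoset R) where
  le P Q := R.sep P ⊆ R.sep Q
  le_refl _ := subset_rfl
  le_trans _ _ _ := Set.Subset.trans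
  le_antisymm P Q h h' := Tope.eq_of_sep_eq R P Q (Set.Subset.antisymm h h')

/-- The topes `T` with `T_e = -R_e`, with the order induced from `𝒯_R`. -/
abbrev OppositeTopes (R : L.Tope) (e : E) : Type _ :=
  {T : TopePoset R // Tope.sign T e = -R.sign e}

/-- The tope underlying an element of `OppositeTopes R e`. -/
def OppositeTopes.tope {R : L.Tope} {e : E} (Q : OppositeTopes R e) : L.Tope := Q.1

/-- The poset `𝒯_{R,e}`: the topes `T` with `T_e = -R_e`, together with a new least
element `0̂ = ⊥`. -/
abbrev PointedTopes (R : L.Tope) (e : E) : Type _ := WithBot (OppositeTopes R e)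

instance [Finite E] : Finite L.Tope :=
  inferInstanceAs (Finite {T : E → SignType //
    T ∈ L.covectors ∧ ∀ X ∈ L.covectors, signLE T X → X = T})

instance [Finite E] (R : L.Tope) : Finite (TopePoset R) :=
  inferInstanceAs (Finite L.Tope)

instance [Finite E] (R : L.Tope) (e : E) : Finite (PointedTopes R e) :=
  inferInstanceAs (Finite (Option (OppositeTopes R e)))

noncomputable instance [Finite E] (R : L.Tope) (e : E) : Fintype (OppositeTopes R e) :=
  Fintype.ofFinite _

end OrientedMatroid

open Classical in
/-- The Möbius number of a finite poset `P`: the value `μ(0̂, 1̂)` of the Möbius function of the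
poset obtained from `P` by adjoining a new least element `0̂` and a new greatest element `1̂`. -/
noncomputable def mobiusNumber (P : Type*) [PartialOrder P] [Finite P] : ℤ :=
  letI : Fintype (WithBot (WithTop P)) :=
    @Fintype.ofFinite _ (inferInstanceAs (Finite (Option (Option P))))
  letI : LocallyFiniteOrder (WithBot (WithTop P)) := Fintype.toLocallyFiniteOrder
  IncidenceAlgebra.mu ℤ (⊥ : WithBot (WithTop P)) ⊤

/-! ### Summation and Möbius functions on finite posets. -/

section FinitePosets

open Classical

/-! By Möbius inversion over subsets of `E`, it suffices that the Möbius numbers of the `Q` with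
`Sep(P,Q) ∩ Sep(Q,R) ⊆ S` sum to -1 for every `S` (`sum_mobiusNumber_sep_subset`). For `S = ∅` the
condition says `Q ≼_R P`, so this is the recursion defining the Möbius function, and it has only one
solution. Hence any function on the opposite topes with all these sums equal to -1 is the Möbius
number. Such a function comes from an Euler-characteristic-like weight on covectors, of total 1 on
every cone (`exists_weight`): push it forward along `X ↦ X ∘ (-R)` and negate
(`exists_tope_weight`). The weight is defined by its sums over stars; `sum_weight_region` passes to
cones by cutting with one hyperplane at a time. -/

/-- A function on a finite strict order is obtained by summing a function over upper sets. -/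
theorem exists_add_sum_eq {α : Type*} [Fintype α] (r : α → α → Prop)
    (hirr : ∀ x, ¬ r x x) (htr : ∀ x y z, r x y → r y z → r x z) (g : α → ℤ) :
    ∃ w : α → ℤ, ∀ x, w x + ∑ y with r x y, w y = g x := by
  have : Std.Irrefl (Function.swap r) := ⟨fun x => hirr x⟩
  have : IsTrans α (Function.swap r) := ⟨fun x y z h h' => htr z y x h' h⟩
  -- The values are defined by recursion downwards from the maximal elements.
  have wf : WellFounded (Function.swap r) := Finite.wellFounded_of_trans_of_irrefl _
  let F : ∀ x, (∀ y, Function.swap r y x → ℤ) → ℤ := fun x ih =>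
    g x - ∑ y, if h : r x y then ih y h else 0
  refine ⟨wf.fix F, fun x => ?_⟩
  rw [wf.fix_eq]
  simp only [F, Finset.sum_filter]
  simp

/-- A function on a finite poset is determined by its sums over principal lower sets. -/
theorem eq_of_sum_le_eq {α : Type*} [PartialOrder α] [Fintype α] (f g : α → ℤ)
    (h : ∀ x, ∑ y with y ≤ x, f y = ∑ y with y ≤ x, g y) : f = g := by
  funext x
  induction x using WellFoundedLT.induction with
  | _ x ih =>
    have key : ∀ k : α → ℤ, ∑ y with y ≤ x, k y = k x + ∑ y with y < x, k y := fun k => by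
      have : Finset.univ.filter (fun y => y ≤ x) = insert x (Finset.univ.filter (fun y => y < x)) := by
        ext y
        simp [le_iff_eq_or_lt]
      rw [this, Finset.sum_insert (by simp)]
    have hx := h x
    rw [key, key, Finset.sum_congr rfl (fun y hy => ih y (by simpa using hy))] at hx
    exact add_right_cancel hx

/-- The Möbius function is preserved by embeddings onto order-connected subsets. -/
theorem mu_map_orderEmbedding {α β : Type*} [PartialOrder α] [PartialOrder β]
    [LocallyFiniteOrder α] [LocallyFiniteOrder β] [DecidableEq α] [DecidableEq β]
    [WellFoundedLT α]
    (φ : α ↪o β) (hφ : (Set.range φ).OrdConnected) (a b : α) :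
    IncidenceAlgebra.mu ℤ (φ a) (φ b) = IncidenceAlgebra.mu ℤ a b := by
  induction b using WellFoundedLT.induction with
  | _ b ih =>
    by_cases hab : a = b
    · subst hab; simp
    · rw [IncidenceAlgebra.mu_eq_neg_sum_Ico_of_ne hab,
        IncidenceAlgebra.mu_eq_neg_sum_Ico_of_ne (fun h => hab (φ.injective h))]
      congr 1
      -- Order-connectedness puts every point between two images into the range.
      have : Finset.Ico (φ a) (φ b) = (Finset.Ico a b).map φ.toEmbedding := by
        ext y
        simp only [Finset.mem_Ico, Finset.mem_map]
        constructor
        · rintro ⟨h1, h2⟩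
          obtain ⟨x, rfl⟩ := hφ.out (Set.mem_range_self a) (Set.mem_range_self b) ⟨h1, h2.le⟩
          exact ⟨x, ⟨φ.le_iff_le.1 h1, φ.lt_iff_lt.1 h2⟩, rfl⟩
        · rintro ⟨x, ⟨h1, h2⟩, rfl⟩
          exact ⟨φ.le_iff_le.2 h1, φ.lt_iff_lt.2 h2⟩
      rw [this, Finset.sum_map]
      exact Finset.sum_congr rfl fun x hx => ih x (Finset.mem_Ico.1 hx).2

/-- The Möbius number of an open interval is the value of the Möbius function. -/
theorem mobiusNumber_Ioo {α : Type*} [PartialOrder α] [Finite α] [LocallyFiniteOrder α]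
    [DecidableEq α]
    {a b : α} (hab : a < b) :
    mobiusNumber (Set.Ioo a b) = IncidenceAlgebra.mu ℤ a b := by
  let f : WithBot (WithTop (Set.Ioo a b)) → α := fun x =>
    match x with
    | none => a
    | some none => b
    | some (some x) => x
  have hf : ∀ x y, f x ≤ f y ↔ x ≤ y := by
    intro x y
    induction x using WithBot.recBotCoe with
    | bot =>
      refine ⟨fun _ => bot_le, fun _ => ?_⟩
      induction y using WithBot.recBotCoe with
      | bot => exact le_rfl
      | coe y =>
        induction y using WithTop.recTopCoe with
        | top => exact hab.le
        | coe y => exact y.2.1.le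
    | coe x =>
      induction y using WithBot.recBotCoe with
      | bot =>
        refine ⟨fun h => absurd h ?_, fun h => absurd h (by simp)⟩
        induction x using WithTop.recTopCoe with
        | top => exact not_le_of_gt hab
        | coe x => exact not_le_of_gt x.2.1
      | coe y =>
        rw [WithBot.coe_le_coe]
        induction y using WithTop.recTopCoe with
        | top =>
          refine ⟨fun _ => le_top, fun _ => ?_⟩
          induction x using WithTop.recTopCoe with
          | top => exact le_rfl
          | coe x => exact x.2.2.le
        | coe y =>
          induction x using WithTop.recTopCoe with
          | top => exact ⟨fun h => absurd h (not_le_of_gt y.2.2), fun h => absurd h (by simp)⟩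
          | coe x => rw [WithTop.coe_le_coe]; exact Iff.rfl
  let φ : WithBot (WithTop (Set.Ioo a b)) ↪o α := OrderEmbedding.ofMapLEIff f hf
  have hφ : (Set.range φ).OrdConnected := by
    have : Set.range φ = Set.Icc a b := by
      ext z
      constructor
      · rintro ⟨x, rfl⟩
        exact ⟨(hf ⊥ x).2 bot_le, (hf x ⊤).2 le_top⟩
      · rintro ⟨h1, h2⟩
        rcases h1.eq_or_lt with rfl | h1
        · exact ⟨⊥, rfl⟩
        rcases h2.eq_or_lt with rfl | h2
        · exact ⟨⊤, rfl⟩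
        · exact ⟨(((⟨z, h1, h2⟩ : Set.Ioo a b) : WithTop _) : WithBot _), rfl⟩
    rw [this]
    exact Set.ordConnected_Icc
  have : Finite (WithBot (WithTop (Set.Ioo a b))) :=
    inferInstanceAs (Finite (Option (Option (Set.Ioo a b))))
  unfold mobiusNumber
  exact (@mu_map_orderEmbedding _ _ _ _ (_) _ (_) _ _ φ hφ ⊥ ⊤).symm

end FinitePosets

section SignVectors

variable {E : Type*}

theorem signComp_of_ne {X Y : E → SignType} {f : E} (h : X f ≠ 0) : signComp X Y f = X f := by
  simp [signComp, h]

theorem signComp_of_eq {X Y : E → SignType} {f : E} (h : X f = 0) : signComp X Y f = Y f := by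
  simp [signComp, h]

end SignVectors

namespace OrientedMatroid

/-! ### Weights on covectors and their sums over cones. -/

section Regions

open Classical

variable {E : Type*}

/-- The contraction of an element, which stays in the ground set as a loop. -/
def contractElem (L : OrientedMatroid E) (g : E) : OrientedMatroid E where
  covectors := {X | X ∈ L.covectors ∧ X g = 0}
  zero_mem := ⟨L.zero_mem, rfl⟩
  neg_mem := fun X hX => ⟨L.neg_mem X hX.1, by simp [hX.2]⟩
  comp_mem := fun X hX Y hY => ⟨L.comp_mem X hX.1 Y hY.1, by simp [signComp, hX.2, hY.2]⟩
  elim := fun X hX Y hY e he => by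
    obtain ⟨Z, hZ, hZe, h⟩ := L.elim X hX.1 Y hY.1 e he
    refine ⟨Z, ⟨hZ, ?_⟩, hZe, h⟩
    rw [(h g (fun hg => hg.2 hX.2)).1, signComp_of_eq hX.2, hY.2]

variable [Fintype E]

/-- Weights summing to `1` over the star of each covector in a cone sum to `1` over the cone. -/
theorem sum_weight_region (n : ℕ) : ∀ (L : OrientedMatroid E) (w : (E → SignType) → ℤ)
    (B : Set E) (T : E → SignType), T ∈ L.covectors → (∀ f ∈ B, T f ≠ 0) →
    (∀ X ∈ L.covectors, (∀ f ∈ B, X f = T f) →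
      ∑ Y with Y ∈ L.covectors ∧ signLE X Y, w Y = 1) →
    {f | f ∉ B ∧ ∃ X ∈ L.covectors, X f ≠ 0}.ncard = n →
    ∑ Y with Y ∈ L.covectors ∧ ∀ f ∈ B, Y f = T f, w Y = 1 := by
  induction n using Nat.strong_induction_on with
  | _ n ih =>
  intro L w B T hT hTB hw hn
  by_cases hne : ∃ g, g ∉ B ∧ ∃ X ∈ L.covectors, X g ≠ 0
  swap
  -- Only loops lie outside `B`, so the cone is the star of `T`.
  · rw [← hw T hT (fun _ _ => rfl)]
    congr 1
    ext Y
    simp only [Finset.mem_filter, Finset.mem_univ, true_and, and_congr_right_iff]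
    intro hY
    constructor
    · intro h f
      by_cases hf : f ∈ B
      · exact Or.inr (h f hf).symm
      · by_contra hc
        exact hne ⟨f, hf, T, hT, fun h0 => hc (Or.inl h0)⟩
    · intro h f hf
      exact ((h f).resolve_left (hTB f hf)).symm
  obtain ⟨g, hgB, V, hV, hVg⟩ := hne
  have hVs : ∀ s : SignType, s ≠ 0 → ∃ X ∈ L.covectors, X g = s := by
    intro s hs
    by_cases h : V g = s
    · exact ⟨V, hV, h⟩
    · refine ⟨_, L.neg_mem V hV, ?_⟩
      revert hs h hVg
      generalize V g = v
      revert v s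
      decide
  -- cones cut out by a larger set of elements
  have big : ∀ (B' : Set E) (T' : E → SignType), T' ∈ L.covectors → (∀ f ∈ B', T' f ≠ 0) →
      B ⊆ B' → g ∈ B' → (∀ f ∈ B, T' f = T f) →
      ∑ Y with Y ∈ L.covectors ∧ ∀ f ∈ B', Y f = T' f, w Y = 1 := by
    intro B' T' hT' hTB' hBB' hgB' hTT'
    refine ih _ ?_ L w B' T' hT' hTB' (fun X hX hXB => hw X hX fun f hf => ?_) rfl
    · rw [← hn]
      refine Set.ncard_lt_ncard ⟨fun f hf => ⟨fun h => hf.1 (hBB' h), hf.2⟩, fun h => ?_⟩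
        (Set.toFinite _)
      exact (h ⟨hgB, V, hV, hVg⟩ : g ∉ B' ∧ _).1 hgB'
    · rw [hXB f (hBB' hf), hTT' f hf]
  have split : ∀ (p : (E → SignType) → Prop) [DecidablePred p], ∑ Y with p Y, w Y =
      (∑ Y with p Y ∧ Y g = 1, w Y) + (∑ Y with p Y ∧ Y g = -1, w Y)
        + ∑ Y with p Y ∧ Y g = 0, w Y := by
    intro p _
    simp only [Finset.sum_filter, ← Finset.sum_add_distrib]
    refine Finset.sum_congr rfl fun Y _ => ?_
    by_cases hp : p Y
    · rcases h : Y g <;> simp [hp]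
    · simp [hp]
  -- half-cones of cones that are cut out by a subset of the support of `X`
  have half : ∀ (C : Set E) (X : E → SignType), X ∈ L.covectors → (∀ f ∈ C, X f ≠ 0) →
      B ⊆ C → (∀ f ∈ B, X f = T f) → X g = 0 → ∀ s : SignType, s ≠ 0 →
      ∑ Y with (Y ∈ L.covectors ∧ ∀ f ∈ C, Y f = X f) ∧ Y g = s, w Y = 1 := by
    intro C X hX hXC hBC hXB hXg s hs
    obtain ⟨W, hW, hWg⟩ := hVs s hs
    -- `X ∘ W` keeps the signs of `X` on `C` and has sign `s` at `g`.
    have h := big (insert g C) (signComp X W) (L.comp_mem X hX W hW) ?_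
      (fun f hf => Or.inr (hBC hf)) (Or.inl rfl)
      (fun f hf => by rw [signComp_of_ne (hXC f (hBC hf)), hXB f hf])
    · rw [← h]
      congr 1
      ext Y
      simp only [Finset.mem_filter, Finset.mem_univ, true_and, Set.forall_mem_insert,
        signComp_of_eq hXg, hWg, and_assoc]
      refine and_congr_right fun _ => ?_
      rw [and_comm]
      refine and_congr_right fun _ => forall₂_congr fun f hf => ?_
      rw [signComp_of_ne (hXC f hf)]
    · rintro f (rfl | hf)
      · rwa [signComp_of_eq hXg, hWg]
      · rw [signComp_of_ne (hXC f hf)]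
        exact hXC f hf
  -- If the hyperplane of `g` meets the cone, both halves have sum 1 and the slice has sum -1, as 1
  -- + 1 - 1 = 1.
  by_cases h0 : ∃ X ∈ L.covectors, (∀ f ∈ B, X f = T f) ∧ X g = 0
  · obtain ⟨X, hX, hXB, hXg⟩ := h0
    have hXB0 : ∀ f ∈ B, X f ≠ 0 := fun f hf => by rw [hXB f hf]; exact hTB f hf
    have hp := half B X hX hXB0 subset_rfl hXB hXg
    -- Induction applies to the slice with the weights negated: a star centred on the hyperplane has
    -- sum 1 with both open halves of sum 1, leaving -1.
    have hz := ih _ ?_ (L.contractElem g) (fun Y => -w Y) B X ⟨hX, hXg⟩ hXB0 ?_ rfl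
    · have e : Finset.univ.filter (fun Y => Y ∈ L.covectors ∧ ∀ f ∈ B, Y f = T f) =
          Finset.univ.filter (fun Y => Y ∈ L.covectors ∧ ∀ f ∈ B, Y f = X f) :=
        Finset.filter_congr fun Y _ => and_congr_right fun _ =>
          forall₂_congr fun f hf => by rw [hXB f hf]
      rw [e, split, hp 1 (by decide), hp (-1) (by decide)]
      rw [Finset.sum_neg_distrib] at hz
      have e2 : Finset.univ.filter (fun Y =>
            Y ∈ (L.contractElem g).covectors ∧ ∀ f ∈ B, Y f = X f) =
          Finset.univ.filter (fun Y => (Y ∈ L.covectors ∧ ∀ f ∈ B, Y f = X f) ∧ Y g = 0) :=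
        Finset.filter_congr fun Y _ => and_right_comm
      rw [e2] at hz
      linarith
    · rw [← hn]
      refine Set.ncard_lt_ncard ⟨?_, fun h => ?_⟩ (Set.toFinite _)
      · rintro f ⟨hf, Y, hY, hYf⟩
        exact ⟨hf, Y, hY.1, hYf⟩
      · obtain ⟨-, Y, hY, hYg⟩ := h ⟨hgB, V, hV, hVg⟩
        exact hYg hY.2
    · intro Z hZ hZB
      have hZT : ∀ f ∈ B, Z f = T f := fun f hf => by rw [hZB f hf, hXB f hf]
      -- The star of `Z` is the cone cut out by the support of `Z`.
      obtain ⟨C, hC⟩ : ∃ C : Set E, ∀ f, f ∈ C ↔ Z f ≠ 0 := ⟨{f | Z f ≠ 0}, fun _ => Iff.rfl⟩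
      have hs := half C Z hZ.1 (fun f h => (hC f).1 h)
        (fun f hf => by
          rw [hC, hZT f hf]; exact hTB f hf) hZT hZ.2
      have h1 := hw Z hZ.1 hZT
      have e : ∀ Y : E → SignType, signLE Z Y ↔ ∀ f ∈ C, Y f = Z f := fun Y =>
        forall_congr' fun f => by
          rw [hC, eq_comm (a := Z f) (b := Y f)]; tauto
      have e1 : Finset.univ.filter (fun Y => Y ∈ L.covectors ∧ signLE Z Y) =
          Finset.univ.filter (fun Y => Y ∈ L.covectors ∧ ∀ f ∈ C, Y f = Z f) :=
        Finset.filter_congr fun Y _ => and_congr_right fun _ => e Y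
      have e2 : Finset.univ.filter (fun Y => Y ∈ (L.contractElem g).covectors ∧ signLE Z Y) =
          Finset.univ.filter (fun Y =>
            (Y ∈ L.covectors ∧ ∀ f ∈ C, Y f = Z f) ∧ Y g = 0) :=
        Finset.filter_congr fun Y _ => (and_congr_right fun _ => e Y).trans and_right_comm
      rw [e1] at h1
      rw [split, hs 1 (by decide), hs (-1) (by decide)] at h1
      rw [Finset.sum_neg_distrib, e2]
      linarith
  · have hTg : T g ≠ 0 := fun h => h0 ⟨T, hT, fun _ _ => rfl, h⟩
    rw [← big (insert g B) T hT ?_ (Set.subset_insert _ _) (Set.mem_insert _ _) fun _ _ => rfl]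
    · congr 1
      ext Y
      simp only [Finset.mem_filter, Finset.mem_univ, true_and, Set.forall_mem_insert]
      refine and_congr_right fun hY => ⟨fun h => ⟨?_, h⟩, fun h => h.2⟩
      -- Otherwise, eliminating `g` between `Y` and `T` gives a covector of the cone on the
      -- hyperplane.
      by_contra hYg
      have hY0 : Y g ≠ 0 := fun h' => h0 ⟨Y, hY, h, h'⟩
      obtain ⟨Z, hZ, hZg, hZf⟩ := L.elim Y hY T hT g ⟨by
        revert hYg hY0 hTg
        generalize Y g = y
        generalize T g = t
        revert y t
        decide, hY0⟩
      refine h0 ⟨Z, hZ, fun f hf => ?_, hZg⟩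
      rw [(hZf f fun hs => ?_).2, signComp_of_ne (hTB f hf)]
      have h1 := hs.1
      have h2 := hTB f hf
      rw [h f hf] at h1
      revert h1 h2
      generalize T f = t
      revert t
      decide
    · rintro f (rfl | hf)
      · exact hTg
      · exact hTB f hf

/-- Every oriented matroid carries weights on its covectors which sum to `1` over all cones. -/
theorem exists_weight (L : OrientedMatroid E) : ∃ w : (E → SignType) → ℤ,
    ∀ (B : Set E), ∀ T ∈ L.covectors, (∀ f ∈ B, T f ≠ 0) →
      ∑ Y with Y ∈ L.covectors ∧ ∀ f ∈ B, Y f = T f, w Y = 1 := by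
  -- Prescribing sum 1 on every star determines `w` recursively.
  obtain ⟨w, hw⟩ := exists_add_sum_eq
    (fun X Y : E → SignType => Y ∈ L.covectors ∧ signLE X Y ∧ X ≠ Y) (by simp)
    (by
      rintro X Y Z ⟨-, h1, h2⟩ ⟨hZ, h3, h4⟩
      refine ⟨hZ, fun f => ?_, ?_⟩
      · rcases h1 f with h | h
        · exact Or.inl h
        · rw [h]; exact h3 f
      · rintro rfl
        refine h4 (funext fun f => ?_)
        rcases h1 f with h | h
        · rcases h3 f with h' | h'
          · rw [h, h']
          · exact h'
        · exact h.symm) (fun _ => 1)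
  refine ⟨w, fun B T hT hTB => sum_weight_region _ L w B T hT hTB (fun X hX _ => ?_) rfl⟩
  rw [← hw X]
  have : Finset.univ.filter (fun Y => Y ∈ L.covectors ∧ signLE X Y) =
      insert X (Finset.univ.filter (fun Y => Y ∈ L.covectors ∧ signLE X Y ∧ X ≠ Y)) := by
    ext Y
    simp only [Finset.mem_filter, Finset.mem_univ, true_and, Finset.mem_insert]
    constructor
    · rintro ⟨h1, h2⟩
      by_cases h : Y = X
      · exact Or.inl h
      · exact Or.inr ⟨h1, h2, Ne.symm h⟩
    · rintro (rfl | h)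
      · exact ⟨hX, fun f => Or.inr rfl⟩
      · exact ⟨h.1, h.2.1⟩
  rw [this, Finset.sum_insert (by simp)]
  congr!

end Regions

/-! ### From covector weights to Möbius numbers of topes. -/

section Topes

open Classical

variable {E : Type*} {L : OrientedMatroid E}

/-- Maximality forces `T ∘ X = T`. -/
theorem Tope.covector_eq_zero (T : L.Tope) {X : E → SignType} (hX : X ∈ L.covectors) {f : E}
    (h : T.sign f = 0) : X f = 0 := by
  have h1 := congrFun (T.2.2 (signComp T.1 X) (L.comp_mem _ T.2.1 _ hX) (fun f => by
    by_cases hf : T.1 f = 0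
    · exact Or.inl hf
    · exact Or.inr (signComp_of_ne hf).symm)) f
  exact ((signComp_of_eq h).symm.trans h1).trans h

/-- The tope `X ∘ (-R)`. -/
def Tope.compNeg (R : L.Tope) (X : E → SignType) (hX : X ∈ L.covectors) : L.Tope :=
  ⟨signComp X (fun f => -R.sign f), L.comp_mem _ hX _ (L.neg_mem _ R.2.1), fun Y hY h => by
    funext f
    rcases h f with h | h
    · have hR : R.sign f = 0 := by
        by_cases hf : X f = 0
        · rw [signComp_of_eq hf] at h
          simpa using h
        · rw [signComp_of_ne hf] at h
          exact absurd h hf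
      rw [h, R.covector_eq_zero hY hR]
    · exact h.symm⟩

/-- The intersection consists of the elements separating `R` from `Q` but not from `P`. -/
theorem sep_inter_sep_eq_empty_iff (R P Q : L.Tope) :
    P.sep Q ∩ Q.sep R ⊆ ∅ ↔ R.sep Q ⊆ R.sep P := by
  rw [Set.subset_empty_iff, Set.eq_empty_iff_forall_notMem]
  refine forall_congr' fun f => ?_
  have a := Tope.eq_zero_of_eq_zero R P f
  have b := Tope.eq_zero_of_eq_zero R Q f
  have c := Tope.eq_zero_of_eq_zero P R f
  have d := Tope.eq_zero_of_eq_zero Q R f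
  change ¬ ((P.sign f = -Q.sign f ∧ P.sign f ≠ 0) ∧ (Q.sign f = -R.sign f ∧ Q.sign f ≠ 0)) ↔
    (R.sign f = -Q.sign f ∧ R.sign f ≠ 0) → (R.sign f = -P.sign f ∧ R.sign f ≠ 0)
  revert a b c d
  generalize R.sign f = r
  generalize P.sign f = p
  generalize Q.sign f = q
  revert r p q
  decide

variable [Fintype E]

/-- Weights on the topes opposite to `R` along `e`, with prescribed sums over cones. -/
theorem exists_tope_weight (R : L.Tope) (e : E) (hR : R.sign e = 1) :
    ∃ h : OppositeTopes R e → ℤ, ∀ (P : L.Tope), P.sign e = -1 → ∀ S : Set E,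
      ∑ Q with P.sep Q.tope ∩ Q.tope.sep R ⊆ S, h Q = -1 := by
  obtain ⟨w, hw⟩ := L.exists_weight
  refine ⟨fun Q => -∑ X with (X ∈ L.covectors ∧ X e = -1) ∧
    signComp X (fun f => -R.sign f) = Q.tope.sign, w X, fun P hP S => ?_⟩
  -- Off `S`, the tope `X ∘ (-R)` must not differ from both `P` and `R` where these agree. A zero of
  -- `X` becomes `-R`, so the condition is exactly `X = P` at such elements; `e` is added because
  -- `X_e = -`.
  obtain ⟨B, hB⟩ : ∃ B : Set E, ∀ f, f ∈ B ↔
      f = e ∨ f ∉ S ∧ P.sign f = R.sign f ∧ P.sign f ≠ 0 :=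
    ⟨{f | f = e ∨ f ∉ S ∧ P.sign f = R.sign f ∧ P.sign f ≠ 0}, fun _ => Iff.rfl⟩
  have hreg := hw B P.sign P.2.1 (by
    intro f hf
    rcases (hB f).1 hf with rfl | hf
    · rw [hP]; decide
    · exact hf.2.2)
  rw [Finset.sum_neg_distrib, ← hreg]
  congr 1
  simp only [Finset.sum_filter (s := (Finset.univ : Finset (E → SignType)))]
  rw [Finset.sum_comm]
  refine Finset.sum_congr rfl fun X _ => ?_
  by_cases hX : X ∈ L.covectors ∧ X e = -1
  swap
  · rw [if_neg, Finset.sum_eq_zero]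
    · intro Q _
      rw [if_neg (fun h => hX h.1)]
    · rintro ⟨h1, h2⟩
      exact hX ⟨h1, by rw [h2 e ((hB e).2 (Or.inl rfl)), hP]⟩
  let Q₀ : OppositeTopes R e := ⟨R.compNeg X hX.1, by
    change signComp X (fun f => -R.sign f) e = -R.sign e
    rw [signComp_of_ne (by rw [hX.2]; decide), hX.2, hR]⟩
  have hQ₀ : ∀ Q : OppositeTopes R e,
      signComp X (fun f => -R.sign f) = Q.tope.sign ↔ Q = Q₀ := by
    intro Q
    constructor
    · intro h
      exact Subtype.ext (Subtype.ext h.symm)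
    · rintro rfl
      rfl
  have hiff : P.sep Q₀.tope ∩ Q₀.tope.sep R ⊆ S ↔
      (X ∈ L.covectors ∧ ∀ f ∈ B, X f = P.sign f) := by
    simp only [hB, or_imp, forall_and, forall_eq, hX.1, hX.2, hP, true_and]
    refine forall_congr' fun f => ?_
    change ((P.sign f = -(if X f = 0 then -R.sign f else X f) ∧ P.sign f ≠ 0) ∧
      ((if X f = 0 then -R.sign f else X f) = -R.sign f ∧
        (if X f = 0 then -R.sign f else X f) ≠ 0)) → f ∈ S ↔
      (f ∉ S ∧ P.sign f = R.sign f ∧ P.sign f ≠ 0) → X f = P.sign f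
    by_cases hf : f ∈ S
    · simp [hf]
    · simp only [hf]
      generalize R.sign f = r
      generalize P.sign f = p
      generalize X f = x
      revert r p x
      decide
  trans if P.sep Q₀.tope ∩ Q₀.tope.sep R ⊆ S then w X else 0
  · simp only [hX, and_self, true_and, hQ₀, Finset.sum_ite_eq', Finset.mem_filter,
      Finset.mem_univ]
  · exact if_congr hiff rfl rfl

/-- This is the Möbius recursion on `[0̂, Q]` with the term `μ(0̂, 0̂) = 1` moved across. -/
theorem sum_mobiusNumber_le (R : L.Tope) (e : E) (Q : OppositeTopes R e) :
    ∑ Q' with Q' ≤ Q,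
      mobiusNumber (Set.Ioo (⊥ : PointedTopes R e) (Q' : PointedTopes R e)) = -1 := by
  let : Fintype (PointedTopes R e) := Fintype.ofFinite _
  let : LocallyFiniteOrder (PointedTopes R e) := Fintype.toLocallyFiniteOrder
  rw [Finset.sum_congr rfl fun (Q' : OppositeTopes R e) _ => mobiusNumber_Ioo
    (show (⊥ : PointedTopes R e) < (Q' : PointedTopes R e) from WithBot.bot_lt_coe Q')]
  have h := IncidenceAlgebra.sum_Icc_mu_right (𝕜 := ℤ) (⊥ : PointedTopes R e) (Q : PointedTopes R e)
  have e1 : Finset.Icc (⊥ : PointedTopes R e) (Q : PointedTopes R e) =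
      insert ⊥ ((Finset.univ.filter (fun Q' => Q' ≤ Q)).map
        ⟨((↑) : OppositeTopes R e → PointedTopes R e), WithBot.coe_injective⟩) := by
    ext x
    induction x using WithBot.recBotCoe with
    | bot => simp
    | coe x => simp
  rw [if_neg (WithBot.bot_ne_coe), e1, Finset.sum_insert (by simp), Finset.sum_map,
    IncidenceAlgebra.mu_self] at h
  change 1 + ∑ Q' with Q' ≤ Q, IncidenceAlgebra.mu ℤ (⊥ : PointedTopes R e) Q' = 0 at h
  linarith

/-- The sum of the Möbius numbers over a cone. -/
theorem sum_mobiusNumber_sep_subset (R P : L.Tope) (e : E) (hR : R.sign e = 1)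
    (hP : P.sign e = -1) (S : Set E) :
    ∑ Q : OppositeTopes R e with P.sep Q.tope ∩ Q.tope.sep R ⊆ S,
      mobiusNumber (Set.Ioo (⊥ : PointedTopes R e) (Q : PointedTopes R e)) = -1 := by
  obtain ⟨h, hh⟩ := exists_tope_weight R e hR
  have heq : (fun Q : OppositeTopes R e =>
      mobiusNumber (Set.Ioo (⊥ : PointedTopes R e) (Q : PointedTopes R e))) = h := by
    -- Only `S = ∅` is used here, with `Q` in the role of `P`.
    refine eq_of_sum_le_eq _ _ fun Q => ?_
    rw [sum_mobiusNumber_le, ← hh Q.tope (by rw [← hR]; exact Q.2) ∅]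
    congr 1
    ext Q'
    simp only [Finset.mem_filter, Finset.mem_univ, true_and]
    exact sep_inter_sep_eq_empty_iff R Q.tope Q'.tope
  rw [← hh P hP S, ← heq]

end Topes

end OrientedMatroid

open OrientedMatroid Classical in
theorem corollary4p3 {E : Type*} [Finite E] (L : OrientedMatroid E) (R P : L.Tope) (e : E)
    (hR : R.sign e = 1) (hP : P.sign e = -1) (S : Set E) (heS : e ∉ S) :
    (∑ Q : OppositeTopes R e with
        Q.tope ∈ L.supertope ∅ {e} ∧ S = P.sep Q.tope ∩ Q.tope.sep R,
      mobiusNumber (Set.Ioo (⊥ : PointedTopes R e) (Q : PointedTopes R e)))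
      = if S = ∅ then -1 else 0 := by
  have := Fintype.ofFinite E
  have hst : ∀ Q : OppositeTopes R e, Q.tope ∈ L.supertope ∅ {e} := fun Q =>
    ⟨fun f hf => absurd hf (Set.notMem_empty f), fun f hf => by
      rw [Set.mem_singleton_iff.1 hf, ← hR]; exact Q.2⟩
  simp only [hst, true_and]
  -- Möbius inversion on the subsets of `E`: both sides have sum -1 over the subsets of each `S`.
  refine congrFun (eq_of_sum_le_eq (fun S : Set E =>
    ∑ Q : OppositeTopes R e with S = P.sep Q.tope ∩ Q.tope.sep R,
      mobiusNumber (Set.Ioo (⊥ : PointedTopes R e) (Q : PointedTopes R e)))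
    (fun S => if S = ∅ then -1 else 0) fun S => ?_) S
  trans -1
  · rw [← sum_mobiusNumber_sep_subset R P e hR hP S]
    simp only [Finset.sum_filter (s := (Finset.univ : Finset (OppositeTopes R e)))]
    rw [Finset.sum_comm]
    refine Finset.sum_congr rfl fun Q _ => ?_
    simp
  · simp
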